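/- Let $\mathcal K$ be a real Hilbert space, let $B,D\colon\mathcal K\to 2^{\mathcal K}$ be maximally monotone, let $E\colon\mathcal K\to\mathcal K$ be monotone and $\delta$-Lipschitz continuous ($\delta\ge 0$), and let $F\colon\mathcal K\to\mathcal K$ be $\beta^{-1}$-cocoercive for some $\beta>0$, i.e. $\langle Fx-Fy,x-y\rangle\ge\beta^{-1}\|Fx-Fy\|^2$ for all $x,y\in\mathcal K$; if $F=0$, the choice $\beta=0$ is also allowed. Assume that the primal problem $$0\in By+Dy+Ey+Fy \qquad (\mathrm P)$$ has a solution $y\in\mathcal K$. Consider also the primal-dual problem of finding $(y,z)\in\mathcal K\times\mathcal K$ with $$0\in By+z+Ey+Fy,\qquad 0\in D^{-1}z-y. \qquad (\mathrm{PD})$$ Let $\tau,\varsigma>0$ and let $y_0,y_{-1},z_0\in\mathcal K$. The forward-half-reflected-Douglas–Rachford method is the iteration, for $k=0,1,2,\dots$, $$\begin{aligned} y_{k+1}&=(\mathrm{Id}+\tau B)^{-1}\bigl(y_k-\tau z_k-\tau(2Ey_k-Ey_{k-1})-\tau Fy_k\bigr),\\ \hat y_{k+1}&=(\mathrm{Id}+\varsigma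 D)^{-1}\bigl(\varsigma z_k+2y_{k+1}-y_k\bigr),\\ z_{k+1}&=z_k+\varsigma^{-1}\bigl(2y_{k+1}-y_k-\hat y_{k+1}\bigr). \end{aligned}$$ If $$\tau\bigl(\varsigma^{-1}+2\delta+\tfrac12\beta\bigr)<1,$$ then the iteration generates uniquely determined infinite sequences $(y_k)$ and $(z_k)$, and there are $y^\star,z^\star\in\mathcal K$ such that $y_k\rightharpoonup y^\star$ and $z_k\rightharpoonup z^\star$ weakly, $y^\star$ is a solution of $(\mathrm P)$, and $(y^\star,z^\star)$ is a solution of $(\mathrm{PD})$. In particular, when $F=0$ the iteration is the forward-reflected-Douglas–Rachford method (the same iteration without the term $-\tau Fy_k$), and the same conclusions hold for it under the condition $\tau(\varsigma^{-1}+2\delta)<1$. -/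

import Mathlib

open Filter Topology
open scoped InnerProductSpace NNReal

namespace FHRDR

section

variable {K : Type*} [NormedAddCommGroup K] [InnerProductSpace ℝ K]

/-- A set-valued operator `A : K → 2^K` (with graph `{(x, u) | u ∈ A x}`) is monotone. -/
def IsMonotoneOp (A : K → Set K) : Prop :=
  ∀ x u y v : K, u ∈ A x → v ∈ A y → 0 ≤ ⟪u - v, x - y⟫_ℝ

/-- Maximally monotone: monotone, and maximal among monotone operators for inclusion of graphs
(which is the pointwise inclusion order on `K → Set K`). -/
def IsMaximallyMonotone (A : K → Set K) : Prop :=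
  Maximal IsMonotoneOp A

/-- `F` is `β⁻¹`-cocoercive (for `β > 0`):
`⟪F x - F y, x - y⟫ ≥ β⁻¹ ‖F x - F y‖²` for all `x, y`. -/
def IsCocoercive (β : ℝ) (F : K → K) : Prop :=
  0 < β ∧ ∀ x y : K, β⁻¹ * ‖F x - F y‖ ^ 2 ≤ ⟪F x - F y, x - y⟫_ℝ

/-- The inverse of a set-valued operator: `v ∈ D⁻¹ z` iff `z ∈ D v`. -/
def opInv (D : K → Set K) : K → Set K := fun z => {v | z ∈ D v}

/-- The set-valued operator `Id + τ B`. -/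
def idAddSMul (τ : ℝ) (B : K → Set K) : K → Set K := fun x => {w | ∃ b ∈ B x, w = x + τ • b}

/-- The resolvent `(Id + τ B)⁻¹`, as the set-valued inverse of `Id + τ B`. -/
def resolvent (τ : ℝ) (B : K → Set K) : K → Set K := opInv (idAddSMul τ B)

/-- The sequence `k ↦ y_{k-1}` (`k ≥ 0`), given `y_{-1}` and `(y_k)_{k ≥ 0}`. -/
def prev (ym1 : K) (y : ℕ → K) : ℕ → K
  | 0 => ym1
  | k + 1 => y k

/-- Weak convergence `x_k ⇀ x`. -/
def WeaklyConverges (x : ℕ → K) (l : K) : Prop :=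
  Tendsto (fun k => toWeakSpace ℝ K (x k)) atTop (𝓝 (toWeakSpace ℝ K l))

/-- `(y_k)`, `(z_k)` are generated by the forward-half-reflected-Douglas--Rachford method started
at `y_0`, `y_{-1}`, `z_0`:
`y_{k+1} = (Id + τ B)⁻¹ (y_k - τ z_k - τ (2 E y_k - E y_{k-1}) - τ F y_k)`,
`ŷ_{k+1} = (Id + ς D)⁻¹ (ς z_k + 2 y_{k+1} - y_k)`,
`z_{k+1} = z_k + ς⁻¹ (2 y_{k+1} - y_k - ŷ_{k+1})`. -/
def IsFHRDR (B D : K → Set K) (E F : K → K) (τ ς : ℝ) (y₀ ym1 z₀ : K) (y z : ℕ → K) : Prop :=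
  y 0 = y₀ ∧ z 0 = z₀ ∧ ∀ k : ℕ,
    y (k + 1) ∈ resolvent τ B
      (y k - τ • z k - τ • ((2 : ℝ) • E (y k) - E (prev ym1 y k)) - τ • F (y k)) ∧
    ∃ yhat : K,
      yhat ∈ resolvent ς D (ς • z k + (2 : ℝ) • y (k + 1) - y k) ∧
      z (k + 1) = z k + ς⁻¹ • ((2 : ℝ) • y (k + 1) - y k - yhat)

/-- `(y_k)`, `(z_k)` are generated by the forward-reflected-Douglas--Rachford method (the method
without a cocoercive term) started at `y_0`, `y_{-1}`, `z_0`. -/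
def IsFRDR (B D : K → Set K) (E : K → K) (τ ς : ℝ) (y₀ ym1 z₀ : K) (y z : ℕ → K) : Prop :=
  y 0 = y₀ ∧ z 0 = z₀ ∧ ∀ k : ℕ,
    y (k + 1) ∈ resolvent τ B
      (y k - τ • z k - τ • ((2 : ℝ) • E (y k) - E (prev ym1 y k))) ∧
    ∃ yhat : K,
      yhat ∈ resolvent ς D (ς • z k + (2 : ℝ) • y (k + 1) - y k) ∧
      z (k + 1) = z k + ς⁻¹ • ((2 : ℝ) • y (k + 1) - y k - yhat)

end

section

variable {K G : Type*} [NormedAddCommGroup K] [InnerProductSpace ℝ K] [CompleteSpace K]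
  [NormedAddCommGroup G] [InnerProductSpace ℝ G] [CompleteSpace G]

/-- `y` solves the primal problem `0 ∈ B y + V* D (V y) + E y + F y`. -/
def IsPrimalSolution (B : K → Set K) (D : G → Set G) (V : K →L[ℝ] G) (E F : K → K) (y : K) :
    Prop :=
  ∃ b ∈ B y, ∃ d ∈ D (V y), 0 = b + V.adjoint d + E y + F y

/-- `(y, z)` solves the primal-dual problem
`0 ∈ B y + V* z + E y + F y` and `0 ∈ D⁻¹ z - V y`. -/
def IsPrimalDualSolution (B : K → Set K) (D : G → Set G) (V : K →L[ℝ] G) (E F : K → K)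
    (y : K) (z : G) : Prop :=
  (∃ b ∈ B y, 0 = b + V.adjoint z + E y + F y) ∧ ∃ v ∈ opInv D z, 0 = v - V y

/-- The standing assumptions on the primal-dual problem. The convention for a vanishing
cocoercive term is that `β = 0` when `F = 0`. -/
structure ProblemAssumptions (B : K → Set K) (D : G → Set G) (V : K →L[ℝ] G) (E F : K → K)
    (δ : ℝ≥0) (β : ℝ) : Prop where
  maxMono_B : IsMaximallyMonotone B
  maxMono_D : IsMaximallyMonotone D
  mono_E : IsMonotoneOp (fun x => {E x})
  lipschitz_E : LipschitzWith δ E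
  cocoercive_F : IsCocoercive β F ∨ (F = 0 ∧ β = 0)
  exists_solution : ∃ y, IsPrimalSolution B D V E F y

end

end FHRDR

namespace FHRDR

/-! ### Weak convergence and weak compactness in Hilbert space -/

section WeakLimits

variable {K : Type*} [NormedAddCommGroup K] [InnerProductSpace ℝ K] [CompleteSpace K]

/-! Eliminating the resolvents gives one inclusion in `B` at `y (k + 1)` and one in `D`, with `z (k
+ 1)` as a value (`IsFHRDR.inclusions`). This is a forward-backward step for (PD) in the metric
`τ⁻¹‖a‖² - 2⟪a, b⟫ + ς‖b‖²` on `K × K`, with a reflected evaluation of `E`.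

Monotonicity against a solution `(ys, zs)` shows that the squared metric distance to it, corrected
by `- 2⟪E y_k - E y_{k-1}, y_k - ys⟫ + δ‖y_k - y_{k-1}‖²`, decreases (`energy_step`). The decrease
is at least the metric square of the step minus `(2δ + β/2)‖y_{k+1} - y_k‖²`, and the step-size
condition is exactly what makes this coercive (`metricForm_coercive`). Hence the iterates are
bounded, the steps vanish, and the metric distance to every solution converges
(`IsFHRDR.asymptotics`).

Weak limits along ultrafilters solve (PD) (`IsFHRDR.mem_of_weak_limit`). Opial's argument makes them
all equal (`weak_limit_unique`), so the whole sequence converges weakly.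

The iteration is well defined by Minty's theorem, proved here from an intersection property of balls
(`exists_forall_inner_nonpos`). -/

theorem weaklyConverges_iff_inner {x : ℕ → K} {l : K} :
    WeaklyConverges x l ↔ ∀ w : K, Tendsto (fun k => ⟪x k, w⟫_ℝ) atTop (𝓝 ⟪l, w⟫_ℝ) := by
  have hinj : Function.Injective ((topDualPairing ℝ K).flip) := by
    intro u v huv
    refine ext_inner_left ℝ fun w => ?_
    have := DFunLike.congr_fun huv (InnerProductSpace.toDual ℝ K w)
    simpa using this
  have h := WeakBilin.tendsto_iff_forall_eval_tendsto (l := atTop)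
    (f := fun k => toWeakSpace ℝ K (x k)) (x := toWeakSpace ℝ K l) _ hinj
  refine h.trans ⟨fun H w => ?_, fun H f => ?_⟩
  · have := H (InnerProductSpace.toDual ℝ K w)
    simp_rw [real_inner_comm w]
    exact this
  · have := H ((InnerProductSpace.toDual ℝ K).symm f)
    simp_rw [real_inner_comm ((InnerProductSpace.toDual ℝ K).symm f),
      InnerProductSpace.toDual_symm_apply] at this
    exact this

/-- A bounded family in a Hilbert space has a weak limit along every ultrafilter. -/
theorem exists_weak_limit_ultrafilter {ι : Type*} (U : Ultrafilter ι) (x : ι → K) (R : ℝ)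
    (hx : ∀ i, ‖x i‖ ≤ R) :
    ∃ l : K, ∀ w : K, Tendsto (fun i => ⟪x i, w⟫_ℝ) U (𝓝 ⟪l, w⟫_ℝ) := by
  -- Banach–Alaoglu, transported by the Riesz isomorphism. Ultrafilters replace subsequences, so no
  -- separability is needed.
  have hc := WeakDual.isCompact_closedBall (𝕜 := ℝ) (E := K) 0 R
  let f : ι → WeakDual ℝ K := fun i => StrongDual.toWeakDual (InnerProductSpace.toDual ℝ K (x i))
  obtain ⟨φ, -, hφ⟩ := hc.ultrafilter_le_nhds (U.map f) (by
    rw [Filter.le_principal_iff]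
    refine Ultrafilter.mem_map.2 (Filter.univ_mem' fun i => ?_)
    simpa [f] using hx i)
  refine ⟨(InnerProductSpace.toDual ℝ K).symm (WeakDual.toStrongDual φ), fun w => ?_⟩
  rw [InnerProductSpace.toDual_symm_apply]
  have ht : Tendsto f U (𝓝 φ) := hφ
  exact ((WeakDual.eval_continuous w).tendsto φ).comp ht

end WeakLimits

/-! ### Intersecting balls, Minty's theorem and resolvents -/

section Minty

variable {K : Type*} [NormedAddCommGroup K] [InnerProductSpace ℝ K]

/-- Chebyshev's sum inequality: the nonpositive double sum of `c i * c j * ⟪a i - a j, b i - b j⟫`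
expands to twice the difference of the two sides. -/
theorem sum_inner_le_inner_sum {ι : Type*} [Fintype ι] (a b : ι → K)
    (h : ∀ i j, ⟪a i - a j, b i - b j⟫_ℝ ≤ 0) (c : ι → ℝ) (hc : ∀ i, 0 ≤ c i)
    (hc1 : ∑ i, c i = 1) :
    ∑ i, c i * ⟪a i, b i⟫_ℝ ≤ ⟪∑ i, c i • a i, ∑ i, c i • b i⟫_ℝ := by
  have h1 : ∑ i, ∑ j, c i * c j * ⟪a i - a j, b i - b j⟫_ℝ ≤ 0 :=
    Finset.sum_nonpos fun i _ => Finset.sum_nonpos fun j _ =>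
      mul_nonpos_of_nonneg_of_nonpos (mul_nonneg (hc i) (hc j)) (h i j)
  have e1 : ∑ i, ∑ j, c i * c j * ⟪a i, b i⟫_ℝ = ∑ i, c i * ⟪a i, b i⟫_ℝ := by
    refine Finset.sum_congr rfl fun i _ => ?_
    calc ∑ j, c i * c j * ⟪a i, b i⟫_ℝ = (∑ j, c j) * (c i * ⟪a i, b i⟫_ℝ) := by
          rw [Finset.sum_mul]; exact Finset.sum_congr rfl fun j _ => by ring
      _ = _ := by rw [hc1, one_mul]
  have e2 : ∑ i, ∑ j, c i * c j * ⟪a j, b j⟫_ℝ = ∑ i, c i * ⟪a i, b i⟫_ℝ := by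
    rw [Finset.sum_comm, ← e1]
    exact Finset.sum_congr rfl fun i _ => Finset.sum_congr rfl fun j _ => by ring
  have e3 : ∑ i, ∑ j, c i * c j * ⟪a i, b j⟫_ℝ = ⟪∑ i, c i • a i, ∑ i, c i • b i⟫_ℝ := by
    rw [sum_inner]
    refine Finset.sum_congr rfl fun i _ => ?_
    rw [inner_sum]
    refine Finset.sum_congr rfl fun j _ => ?_
    rw [real_inner_smul_left, real_inner_smul_right]; ring
  have e4 : ∑ i, ∑ j, c i * c j * ⟪a j, b i⟫_ℝ = ⟪∑ i, c i • a i, ∑ i, c i • b i⟫_ℝ := by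
    rw [Finset.sum_comm, ← e3]
    exact Finset.sum_congr rfl fun i _ => Finset.sum_congr rfl fun j _ => by ring
  have e : ∑ i, ∑ j, c i * c j * ⟪a i - a j, b i - b j⟫_ℝ
      = (∑ i, ∑ j, c i * c j * ⟪a i, b i⟫_ℝ) + (∑ i, ∑ j, c i * c j * ⟪a j, b j⟫_ℝ)
        - (∑ i, ∑ j, c i * c j * ⟪a i, b j⟫_ℝ) - ∑ i, ∑ j, c i * c j * ⟪a j, b i⟫_ℝ := by
    simp only [← Finset.sum_add_distrib, ← Finset.sum_sub_distrib]
    refine Finset.sum_congr rfl fun i _ => Finset.sum_congr rfl fun j _ => ?_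
    simp only [inner_sub_left, inner_sub_right]; ring
  rw [e, e1, e2, e3, e4] at h1
  linarith

/-- Extracts the first-order optimality condition at a maximum: divide by `t` and take `t` small. -/
theorem le_zero_of_forall_mul_le_sq {d q : ℝ} (hq : 0 ≤ q)
    (h : ∀ t : ℝ, 0 < t → t ≤ 1 → t * d ≤ t ^ 2 * q) : d ≤ 0 := by
  by_contra! hd
  set t := min 1 (d / (q + 1)) with ht
  have ht0 : 0 < t := lt_min one_pos (by positivity)
  have h1 : d ≤ t * q := by
    have := h t ht0 (min_le_left _ _)
    rw [pow_two, mul_assoc] at this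
    exact le_of_mul_le_mul_left this ht0
  have h2 : t * (q + 1) ≤ d := by
    rw [← le_div_iff₀ (by positivity)]
    exact min_le_right _ _
  nlinarith

theorem inner_sub_sub_eq (x a b : K) :
    ⟪x - a, x - b⟫_ℝ = ‖x‖ ^ 2 - ⟪x, a + b⟫_ℝ + ⟪a, b⟫_ℝ := by
  simp only [inner_sub_left, inner_sub_right, inner_add_right, real_inner_self_eq_norm_sq,
    real_inner_comm x]
  ring

/-- Finitely many balls with diameters `[a i, b i]`, where `a` and `b` are negatively correlated,
have a common point. -/
theorem exists_forall_inner_nonpos_of_fintype {ι : Type*} [Fintype ι] [Nonempty ι] (a b : ι → K)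
    (h : ∀ i j, ⟪a i - a j, b i - b j⟫_ℝ ≤ 0) :
    ∃ x : K, ∀ i, ⟪x - a i, x - b i⟫_ℝ ≤ 0 := by
  classical
  let S : (ι → ℝ) → K := fun c => ∑ i, c i • (a i + b i)
  let C : (ι → ℝ) → ℝ := fun c => ∑ i, c i * ⟪a i, b i⟫_ℝ
  have hne : (stdSimplex ℝ ι).Nonempty := ⟨_, single_mem_stdSimplex ℝ (Classical.arbitrary ι)⟩
  -- Lagrangian duality for minimizing the largest `⟪x - a i, x - b i⟫`: for weights `c` the
  -- weighted sum is `‖x‖² - ⟪x, S c⟫ + C c`, minimal at `x = S c / 2` with value `C c - ‖S c‖² /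
  -- 4`. The dual value is maximized over the simplex.
  obtain ⟨c, hc, hmax⟩ := (isCompact_stdSimplex ℝ ι).exists_isMaxOn hne
    (f := fun c => C c - ‖S c‖ ^ 2 / 4) (by
      apply Continuous.continuousOn
      fun_prop)
  have hneg : C c - ‖S c‖ ^ 2 / 4 ≤ 0 := by
    have h1 := sum_inner_le_inner_sum a b h c hc.1 hc.2
    have h2 : S c = ∑ i, c i • a i + ∑ i, c i • b i := by
      simp [S, smul_add, Finset.sum_add_distrib]
    have h3 := norm_sub_sq_real (∑ i, c i • a i) (∑ i, c i • b i)
    have h4 := norm_add_sq_real (∑ i, c i • a i) (∑ i, c i • b i)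
    have h5 := sq_nonneg ‖∑ i, c i • a i - ∑ i, c i • b i‖
    rw [h2]
    change C c ≤ _ at h1
    linarith
  refine ⟨(2⁻¹ : ℝ) • S c, fun i => ?_⟩
  -- Optimality of `c` in the direction of the vertex `i`. Together with `hneg` it bounds the `i`-th
  -- expression at `S c / 2` by the dual value, hence by `0`.
  have key : ⟪a i, b i⟫_ℝ - C c - 2⁻¹ * ⟪S c, a i + b i - S c⟫_ℝ ≤ 0 := by
    refine le_zero_of_forall_mul_le_sq (q := ‖a i + b i - S c‖ ^ 2 / 4) (by positivity)
      fun t ht0 ht1 => ?_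
    have hmem : (1 - t) • c + t • Pi.single i 1 ∈ stdSimplex ℝ ι :=
      convex_stdSimplex ℝ ι hc (single_mem_stdSimplex ℝ i) (by linarith) ht0.le (by ring)
    have hle : C ((1 - t) • c + t • Pi.single i 1) - ‖S ((1 - t) • c + t • Pi.single i 1)‖ ^ 2 / 4
      ≤ C c - ‖S c‖ ^ 2 / 4 := hmax hmem
    have hC : C ((1 - t) • c + t • Pi.single i 1) = C c + t * (⟪a i, b i⟫_ℝ - C c) := by
      simp only [C, Pi.add_apply, Pi.smul_apply, smul_eq_mul, add_mul, Finset.sum_add_distrib,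
        mul_assoc, ← Finset.mul_sum]
      have h1 : ∑ j, (Pi.single i 1 : ι → ℝ) j * ⟪a j, b j⟫_ℝ = ⟪a i, b i⟫_ℝ := by
        simp [Pi.single_apply]
      rw [h1]
      ring
    have hS : S ((1 - t) • c + t • Pi.single i 1) = S c + t • (a i + b i - S c) := by
      simp only [S, Pi.add_apply, Pi.smul_apply, smul_eq_mul, add_smul, Finset.sum_add_distrib,
        mul_smul, ← Finset.smul_sum]
      have h1 : ∑ j, (Pi.single i 1 : ι → ℝ) j • (a j + b j) = a i + b i := by
        simp [Pi.single_apply, -smul_add]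
      rw [h1]
      module
    rw [hC, hS, norm_add_sq_real, real_inner_smul_right, norm_smul, mul_pow, Real.norm_eq_abs,
      sq_abs] at hle
    linarith
  rw [inner_sub_right, real_inner_self_eq_norm_sq] at key
  rw [inner_sub_sub_eq, norm_smul, mul_pow, real_inner_smul_left]
  norm_num at key ⊢
  linarith

/-- A weak limit of points lying eventually in the ball with diameter `[a, b]` is in this ball. -/
theorem inner_sub_nonpos_of_weak_limit {ι : Type*} {U : Filter ι} [U.NeBot] {x : ι → K} {l a b : K}
    (hl : ∀ w : K, Tendsto (fun i => ⟪x i, w⟫_ℝ) U (𝓝 ⟪l, w⟫_ℝ))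
    (h : ∀ᶠ i in U, ⟪x i - a, x i - b⟫_ℝ ≤ 0) : ⟪l - a, l - b⟫_ℝ ≤ 0 := by
  have ht : Tendsto (fun i => 2 * ⟪x i, l⟫_ℝ - ‖l‖ ^ 2 - ⟪x i, a + b⟫_ℝ + ⟪a, b⟫_ℝ) U
      (𝓝 (2 * ⟪l, l⟫_ℝ - ‖l‖ ^ 2 - ⟪l, a + b⟫_ℝ + ⟪a, b⟫_ℝ)) :=
    ((((hl l).const_mul 2).sub_const _).sub (hl _)).add_const _
  have := le_of_tendsto ht (h.mono fun i hi => ?_) (b := 0)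
  · rw [inner_sub_sub_eq]
    rw [real_inner_self_eq_norm_sq] at this
    linarith
  · rw [inner_sub_sub_eq] at hi
    have h1 := norm_sub_sq_real (x i) l
    have h2 := sq_nonneg ‖x i - l‖
    linarith

/-- Finite intersections are nonempty, and balls are weakly compact. Inserting a fixed index `i₀` in
every finite set keeps the chosen points in one ball. -/
theorem exists_forall_inner_nonpos [CompleteSpace K] {ι : Type*} (a b : ι → K)
    (h : ∀ i j, ⟪a i - a j, b i - b j⟫_ℝ ≤ 0) :
    ∃ x : K, ∀ i, ⟪x - a i, x - b i⟫_ℝ ≤ 0 := by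
  classical
  rcases isEmpty_or_nonempty ι with hι | ⟨⟨i₀⟩⟩
  · exact ⟨0, fun i => hι.elim i⟩
  have hfin : ∀ s : Finset ι, ∃ x : K, ∀ i ∈ insert i₀ s, ⟪x - a i, x - b i⟫_ℝ ≤ 0 := by
    intro s
    have : Nonempty ↥(insert i₀ s) := ⟨⟨i₀, Finset.mem_insert_self _ _⟩⟩
    obtain ⟨x, hx⟩ := exists_forall_inner_nonpos_of_fintype
      (fun i : ↥(insert i₀ s) => a i) (fun i => b i) fun i j => h i j
    exact ⟨x, fun i hi => hx ⟨i, hi⟩⟩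
  choose x hx using hfin
  have hbd : ∀ s, ‖x s‖ ≤ 2 * (‖a i₀‖ + ‖b i₀‖) := by
    intro s
    have h0 := hx s i₀ (Finset.mem_insert_self _ _)
    rw [inner_sub_sub_eq] at h0
    have h1 := real_inner_le_norm (x s) (a i₀ + b i₀)
    have h2 := norm_add_le (a i₀) (b i₀)
    have h3 := neg_le_of_abs_le (abs_real_inner_le_norm (a i₀) (b i₀))
    by_contra! hlt
    have h4 : 0 ≤ ‖a i₀‖ := norm_nonneg _
    have h5 : 0 ≤ ‖b i₀‖ := norm_nonneg _
    have h6 : 0 < ‖x s‖ := by linarith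
    have h7 := mul_le_mul_of_nonneg_left h2 h6.le
    have h8 := mul_pos h6 (sub_pos.2 hlt)
    have h9 := mul_nonneg (add_nonneg h4 h5) (sub_nonneg.2 hlt.le)
    nlinarith [mul_nonneg h4 h5]
  obtain ⟨l, hl⟩ := exists_weak_limit_ultrafilter (Ultrafilter.of atTop) x _ hbd
  refine ⟨l, fun i => inner_sub_nonpos_of_weak_limit hl ?_⟩
  refine Ultrafilter.of_le (atTop : Filter (Finset ι)) ?_
  filter_upwards [eventually_ge_atTop {i}] with s hs
  exact hx s i (Finset.mem_insert_of_mem (hs (Finset.mem_singleton_self i)))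

/-- Adjoining `(x, u)` to the graph keeps it monotone, so maximality puts the pair in the graph
already. -/
theorem IsMaximallyMonotone.mem_of_forall {A : K → Set K} (hA : IsMaximallyMonotone A) {x u : K}
    (h : ∀ y v, v ∈ A y → 0 ≤ ⟪u - v, x - y⟫_ℝ) : u ∈ A x := by
  classical
  let A' : K → Set K := fun y => A y ∪ {v | y = x ∧ v = u}
  have hmono : IsMonotoneOp A' := by
    rintro y v y' v' (hv | ⟨rfl, rfl⟩) (hv' | ⟨rfl, rfl⟩)
    · exact hA.1 y v y' v' hv hv'
    · have := h y v hv
      rwa [← neg_sub v, ← neg_sub y, inner_neg_neg] at this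
    · exact h y' v' hv'
    · simp
  exact hA.2 hmono (fun y v hv => Or.inl hv) x (Or.inr ⟨rfl, rfl⟩)

/-- **Minty's theorem**: the resolvent of a maximally monotone operator is everywhere defined. -/
theorem IsMaximallyMonotone.exists_mem_resolvent [CompleteSpace K] {A : K → Set K} (hA : IsMaximallyMonotone A)
    {τ : ℝ} (hτ : 0 < τ) (w : K) : ∃ x, x ∈ resolvent τ A w := by
  -- Monotonicity says that the families `w - τ • v` and `y`, over the graph of `A`, are negatively
  -- correlated. A common point `x` of the balls makes `(x, τ⁻¹ • (w - x))` monotonically related to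
  -- the whole graph.
  obtain ⟨x, hx⟩ := exists_forall_inner_nonpos
    (ι := {p : K × K // p.2 ∈ A p.1}) (fun p => w - τ • p.1.2) (fun p => p.1.1) (by
      rintro ⟨⟨y, v⟩, hv⟩ ⟨⟨y', v'⟩, hv'⟩
      have h := hA.1 y v y' v' hv hv'
      have e : w - τ • v - (w - τ • v') = -(τ • (v - v')) := by module
      simp only [e, inner_neg_left, real_inner_smul_left]
      have := mul_nonneg hτ.le h
      linarith)
  refine ⟨x, τ⁻¹ • (w - x), hA.mem_of_forall fun y v hv => ?_, ?_⟩
  · have h := hx ⟨(y, v), hv⟩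
    have e : τ⁻¹ • (w - x) - v = -(τ⁻¹ • (x - (w - τ • v))) := by
      rw [smul_sub, smul_sub, smul_sub, smul_smul, inv_mul_cancel₀ hτ.ne']; module
    rw [e, inner_neg_left, real_inner_smul_left]
    have := mul_nonneg (inv_pos.2 hτ).le (neg_nonneg.2 h)
    simp only at this ⊢
    linarith
  · rw [smul_smul, mul_inv_cancel₀ hτ.ne']; module

theorem IsMonotoneOp.resolvent_unique {A : K → Set K} (hA : IsMonotoneOp A)
    {τ : ℝ} (hτ : 0 < τ) {w x y : K} (hx : x ∈ resolvent τ A w) (hy : y ∈ resolvent τ A w) :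
    x = y := by
  obtain ⟨b, hb, hb'⟩ := hx
  obtain ⟨c, hc, hc'⟩ := hy
  have h := mul_nonneg hτ.le (hA x b y c hb hc)
  have e : x - y = -(τ • (b - c)) := by
    have : x + τ • b = y + τ • c := by rw [← hb', ← hc']
    linear_combination (norm := module) this
  have : ⟪x - y, x - y⟫_ℝ ≤ 0 := by
    nth_rewrite 1 [e]
    rw [inner_neg_left, real_inner_smul_left]
    linarith
  exact sub_eq_zero.1 (real_inner_self_nonpos.1 this)

end Minty

end FHRDR

namespace FHRDR

/-! ### Existence and uniqueness of the iterates -/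

section WellPosed

variable {K : Type*} [NormedAddCommGroup K] [InnerProductSpace ℝ K]

theorem isFRDR_iff_isFHRDR_zero {B D : K → Set K} {E : K → K} {τ ς : ℝ} {y₀ ym1 z₀ : K}
    {y z : ℕ → K} :
    IsFRDR B D E τ ς y₀ ym1 z₀ y z ↔ IsFHRDR B D E 0 τ ς y₀ ym1 z₀ y z := by
  simp only [IsFRDR, IsFHRDR, Pi.zero_apply, smul_zero, sub_zero]

theorem IsFHRDR.eq {B D : K → Set K} {E F : K → K} {τ ς : ℝ} {y₀ ym1 z₀ : K}
    (hB : IsMonotoneOp B) (hD : IsMonotoneOp D) (hτ : 0 < τ) (hς : 0 < ς) {y z y' z' : ℕ → K}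
    (h : IsFHRDR B D E F τ ς y₀ ym1 z₀ y z) (h' : IsFHRDR B D E F τ ς y₀ ym1 z₀ y' z') :
    y = y' ∧ z = z' := by
  obtain ⟨hy0, hz0, hs⟩ := h
  obtain ⟨hy0', hz0', hs'⟩ := h'
  have key : ∀ k, y k = y' k ∧ z k = z' k ∧ prev ym1 y k = prev ym1 y' k := by
    intro k
    induction k with
    | zero => exact ⟨hy0.trans hy0'.symm, hz0.trans hz0'.symm, rfl⟩
    | succ k ih =>
      obtain ⟨ihy, ihz, ihp⟩ := ih
      obtain ⟨h1, v, hv, hz⟩ := hs k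
      obtain ⟨h1', v', hv', hz'⟩ := hs' k
      rw [ihy, ihz, ihp] at h1
      have hy := hB.resolvent_unique hτ h1 h1'
      rw [ihz, hy, ihy] at hv hz
      have hvv := hD.resolvent_unique hς hv hv'
      exact ⟨hy, by rw [hz, hz', hvv], ihy⟩
  exact ⟨funext fun k => (key k).1, funext fun k => (key k).2.1⟩

theorem exists_isFHRDR [CompleteSpace K] {B D : K → Set K} (hB : IsMaximallyMonotone B)
    (hD : IsMaximallyMonotone D) (E F : K → K) {τ ς : ℝ} (hτ : 0 < τ) (hς : 0 < ς)
    (y₀ ym1 z₀ : K) : ∃ y z : ℕ → K, IsFHRDR B D E F τ ς y₀ ym1 z₀ y z := by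
  choose JB hJB using fun w => hB.exists_mem_resolvent hτ w
  choose JD hJD using fun w => hD.exists_mem_resolvent hς w
  let next : K × K × K → K := fun s =>
    JB (s.2.1 - τ • s.2.2 - τ • ((2 : ℝ) • E s.2.1 - E s.1) - τ • F s.2.1)
  let hat : K × K × K → K := fun s => JD (ς • s.2.2 + (2 : ℝ) • next s - s.2.1)
  -- The state is `(y_{k-1}, y_k, z_k)`, which turns the two-step recursion into a one-step one.
  let s : ℕ → K × K × K := fun k => Nat.rec (ym1, y₀, z₀)
    (fun _ s => (s.2.1, next s, s.2.2 + ς⁻¹ • ((2 : ℝ) • next s - s.2.1 - hat s))) k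
  have hprev : ∀ k, prev ym1 (fun k => (s k).2.1) k = (s k).1 := by
    intro k
    cases k <;> rfl
  refine ⟨fun k => (s k).2.1, fun k => (s k).2.2, rfl, rfl, fun k => ⟨?_, hat (s k), ?_, rfl⟩⟩
  · rw [hprev]
    exact hJB _
  · exact hJD _

theorem existsUnique_isFHRDR [CompleteSpace K] {B D : K → Set K} (hB : IsMaximallyMonotone B)
    (hD : IsMaximallyMonotone D) (E F : K → K) {τ ς : ℝ} (hτ : 0 < τ) (hς : 0 < ς)
    (y₀ ym1 z₀ : K) :
    ∃! p : (ℕ → K) × (ℕ → K), IsFHRDR B D E F τ ς y₀ ym1 z₀ p.1 p.2 := by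
  obtain ⟨y, z, h⟩ := exists_isFHRDR hB hD E F hτ hς y₀ ym1 z₀
  refine ⟨(y, z), h, fun p hp => ?_⟩
  have := IsFHRDR.eq hB.1 hD.1 hτ hς hp h
  exact Prod.ext this.1 this.2

/-- The inclusions satisfied by the iterates, with the resolvents eliminated. -/
theorem IsFHRDR.inclusions {B D : K → Set K} {E F : K → K} {τ ς : ℝ} {y₀ ym1 z₀ : K}
    (hτ : 0 < τ) (hς : 0 < ς) {y z : ℕ → K} (h : IsFHRDR B D E F τ ς y₀ ym1 z₀ y z) (k : ℕ) :
    τ⁻¹ • (y k - y (k + 1)) - z k - ((2 : ℝ) • E (y k) - E (prev ym1 y k)) - F (y k)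
      ∈ B (y (k + 1)) ∧
    z (k + 1) ∈ D ((2 : ℝ) • y (k + 1) - y k - ς • (z (k + 1) - z k)) := by
  obtain ⟨⟨b, hb, hb'⟩, v, ⟨d, hd, hd'⟩, hz⟩ := h.2.2 k
  constructor
  · convert hb using 1
    have e : b = τ⁻¹ • (τ • b) := by rw [inv_smul_smul₀ hτ.ne']
    have e' : τ • b = y k - τ • z k - τ • ((2 : ℝ) • E (y k) - E (prev ym1 y k)) - τ • F (y k)
        - y (k + 1) := by rw [hb']; abel
    rw [e, e']
    simp only [smul_sub, inv_smul_smul₀ hτ.ne']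
    abel
  · have e : z (k + 1) = d := by
      have e' : (2 : ℝ) • y (k + 1) - y k - v = ς • (d - z k) := by
        linear_combination (norm := module) hd'
      rw [hz, e', smul_smul, inv_mul_cancel₀ hς.ne']
      module
    have e2 : (2 : ℝ) • y (k + 1) - y k - ς • (z (k + 1) - z k) = v := by
      rw [e]
      linear_combination (norm := module) hd'
    rw [e2, e]
    exact hd

end WellPosed

/-! ### The metric and the energy decrease -/

section Energy

variable {K : Type*} [NormedAddCommGroup K] [InnerProductSpace ℝ K]

/-- The quadratic form of the metric in which the iteration is a forward-backward method. -/
noncomputable def metricForm (τ ς : ℝ) (a b : K) : ℝ := τ⁻¹ * ‖a‖ ^ 2 - 2 * ⟪a, b⟫_ℝ + ς * ‖b‖ ^ 2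

/-- The polar form of `metricForm`. -/
noncomputable def metricInner (τ ς : ℝ) (a b a' b' : K) : ℝ :=
  τ⁻¹ * ⟪a, a'⟫_ℝ - ⟪a, b'⟫_ℝ - ⟪b, a'⟫_ℝ + ς * ⟪b, b'⟫_ℝ

/-- With `θ = τ⁻¹ - γ`, the matrix with rows `(θ, -1)` and `(-1, ς)` is positive definite because `θ
* ς > 1`. The constant `ε` is its determinant over its trace, a lower bound for the smallest
eigenvalue. -/
theorem metricForm_coercive {τ ς γ : ℝ} (hτ : 0 < τ) (hς : 0 < ς) (h : τ * (ς⁻¹ + γ) < 1) :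
    ∃ ε > 0, ∀ a b : K, ε * (‖a‖ ^ 2 + ‖b‖ ^ 2) ≤ metricForm τ ς a b - γ * ‖a‖ ^ 2 := by
  set θ := τ⁻¹ - γ with hθ
  have h1 : ς⁻¹ < θ := by
    have : ς⁻¹ + γ < τ⁻¹ := by
      rw [inv_eq_one_div τ, lt_div_iff₀ hτ]; linarith
    linarith
  have hθ0 : 0 < θ := (inv_pos.2 hς).trans h1
  have h2 : 1 < θ * ς := by
    have := mul_lt_mul_of_pos_right h1 hς
    rwa [inv_mul_cancel₀ hς.ne'] at this
  set ε := (θ * ς - 1) / (θ + ς) with hε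
  have hε0 : 0 < ε := div_pos (by linarith) (by linarith)
  have hεe : ε * (θ + ς) = θ * ς - 1 := div_mul_cancel₀ _ (by positivity)
  have h3 : 0 < θ - ε := by
    have : ε < θ := by
      rw [hε, div_lt_iff₀ (by positivity)]; nlinarith
    linarith
  have h4 : (θ - ε) * (ς - ε) = 1 + ε ^ 2 := by linarith
  refine ⟨ε, hε0, fun a b => ?_⟩
  have hab := real_inner_le_norm a b
  have h5 : 0 ≤ (θ - ε) * ‖a‖ ^ 2 - 2 * (‖a‖ * ‖b‖) + (ς - ε) * ‖b‖ ^ 2 := by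
    refine nonneg_of_mul_nonneg_right (a := θ - ε) ?_ h3
    have e : (θ - ε) * ((θ - ε) * ‖a‖ ^ 2 - 2 * (‖a‖ * ‖b‖) + (ς - ε) * ‖b‖ ^ 2)
        = ((θ - ε) * ‖a‖ - ‖b‖) ^ 2 + ε ^ 2 * ‖b‖ ^ 2 := by
      linear_combination ‖b‖ ^ 2 * h4
    rw [e]; positivity
  have e : metricForm τ ς a b - γ * ‖a‖ ^ 2 = θ * ‖a‖ ^ 2 - 2 * ⟪a, b⟫_ℝ + ς * ‖b‖ ^ 2 := by
    rw [metricForm, hθ]; ring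
  rw [e]
  linarith

/-- One step of the iteration decreases the energy. -/
theorem energy_step {τ ς δ β : ℝ} {a a' c c' e e' g p d : K}
    (hB : 0 ≤ ⟪τ⁻¹ • (a - a') - c - (g - e' + e) - p, a'⟫_ℝ)
    (hD : 0 ≤ ⟪c', (2 : ℝ) • a' - a - ς • (c' - c)⟫_ℝ)
    (hE : 0 ≤ ⟪g, a'⟫_ℝ) (hF : -(β / 4) * ‖a' - a‖ ^ 2 ≤ ⟪p, a'⟫_ℝ) (hδ : 0 ≤ δ)
    (he : ‖e‖ ≤ δ * ‖d‖) :
    metricForm τ ς a' c' - 2 * ⟪e', a'⟫_ℝ + δ * ‖a' - a‖ ^ 2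
      ≤ metricForm τ ς a c - 2 * ⟪e, a⟫_ℝ + δ * ‖d‖ ^ 2
        - (metricForm τ ς (a' - a) (c' - c) - (2 * δ + β / 2) * ‖a' - a‖ ^ 2) := by
  -- In `⟪e, a'⟫ = ⟪e, a⟫ + ⟪e, a' - a⟫` the first term telescopes; the second is absorbed by
  -- Young's inequality.
  have h1 : -(2 * ⟪e, a' - a⟫_ℝ) ≤ δ * ‖d‖ ^ 2 + δ * ‖a' - a‖ ^ 2 := by
    have h2 := neg_le_of_abs_le (abs_real_inner_le_norm e (a' - a))
    have h3 := mul_le_mul_of_nonneg_right he (norm_nonneg (a' - a))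
    have h4 := mul_nonneg hδ (sq_nonneg (‖d‖ - ‖a' - a‖))
    nlinarith
  -- Three-point identity of the metric; the right side is what `hB` and `hD` control.
  have h5 : metricForm τ ς a c - metricForm τ ς a' c' - metricForm τ ς (a' - a) (c' - c)
      = 2 * (τ⁻¹ * ⟪a - a', a'⟫_ℝ - ⟪a - a', c'⟫_ℝ - ⟪c - c', a'⟫_ℝ + ς * ⟪c - c', c'⟫_ℝ) := by
    simp only [metricForm, ← real_inner_self_eq_norm_sq, inner_sub_left, inner_sub_right,
      real_inner_comm a' a, real_inner_comm c' c, real_inner_comm c' a', real_inner_comm c' a,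
      real_inner_comm c a', real_inner_comm c a]
    ring
  simp only [inner_sub_left, inner_sub_right, inner_add_left, real_inner_smul_left,
    real_inner_smul_right] at hB hD hE h1 h5
  have h6 := real_inner_comm a' c'
  have h7 := real_inner_comm a c'
  rw [real_inner_comm c c'] at hD
  linarith

end Energy

end FHRDR

namespace FHRDR

/-! ### Fejér monotonicity, weak limit points and Opial's argument -/

section Convergence

variable {K : Type*} [NormedAddCommGroup K] [InnerProductSpace ℝ K]

theorem IsCocoercive.norm_sub_le {β : ℝ} {F : K → K} (h : IsCocoercive β F) (x y : K) :
    ‖F x - F y‖ ≤ β * ‖x - y‖ := by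
  have h1 := (h.2 x y).trans (real_inner_le_norm _ _)
  rw [inv_mul_le_iff₀ h.1] at h1
  rcases (norm_nonneg (F x - F y)).eq_or_lt' with h0 | h0
  · rw [h0]
    exact mul_nonneg h.1.le (norm_nonneg _)
  · refine le_of_mul_le_mul_left ?_ h0
    linarith

/-- `F` is evaluated at the old iterate `x` but paired with the new one `w`. Completing the square
lets cocoercivity pay for the mismatch, which produces the `β / 2` in the step-size condition. -/
theorem IsCocoercive.le_inner {β : ℝ} {F : K → K} (h : IsCocoercive β F) (x y w : K) :
    -(β / 4) * ‖w - x‖ ^ 2 ≤ ⟪F x - F y, w - y⟫_ℝ := by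
  have hβ := h.1
  have h1 := h.2 x y
  have h2 := neg_le_of_abs_le (abs_real_inner_le_norm (F x - F y) (w - x))
  have e : ⟪F x - F y, w - y⟫_ℝ = ⟪F x - F y, x - y⟫_ℝ + ⟪F x - F y, w - x⟫_ℝ := by
    rw [← inner_add_right]; congr 1; abel
  have e2 : β⁻¹ * ‖F x - F y‖ ^ 2 - ‖F x - F y‖ * ‖w - x‖ + β / 4 * ‖w - x‖ ^ 2
      = β⁻¹ * (‖F x - F y‖ - β / 2 * ‖w - x‖) ^ 2 := by
    field_simp
    ring
  have h3 : 0 ≤ β⁻¹ * (‖F x - F y‖ - β / 2 * ‖w - x‖) ^ 2 := by positivity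
  linarith

section

variable [CompleteSpace K]

theorem isPrimalDualSolution_id_iff {B D : K → Set K} {E F : K → K} {y z : K} :
    IsPrimalDualSolution B D (ContinuousLinearMap.id ℝ K) E F y z ↔
      -(z + E y + F y) ∈ B y ∧ z ∈ D y := by
  have hid : (ContinuousLinearMap.id ℝ K).adjoint z = z :=
    ext_inner_right ℝ fun w => by rw [ContinuousLinearMap.adjoint_inner_left]; rfl
  simp only [IsPrimalDualSolution, hid, ContinuousLinearMap.id_apply, opInv]
  constructor
  · rintro ⟨⟨b, hb, h⟩, v, (hv : z ∈ D v), h'⟩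
    rw [sub_eq_zero.1 h'.symm] at hv
    refine ⟨?_, hv⟩
    convert hb using 1
    linear_combination (norm := module) h
  · rintro ⟨h, h'⟩
    exact ⟨⟨_, h, by abel⟩, y, h', by simp⟩

theorem IsPrimalDualSolution.isPrimalSolution {B D : K → Set K} {E F : K → K} {y z : K}
    (h : IsPrimalDualSolution B D (ContinuousLinearMap.id ℝ K) E F y z) :
    IsPrimalSolution B D (ContinuousLinearMap.id ℝ K) E F y := by
  obtain ⟨⟨b, hb, h⟩, v, hv, h'⟩ := h
  rw [sub_eq_zero.1 h'.symm] at hv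
  exact ⟨b, hb, z, hv, h⟩

theorem IsPrimalSolution.exists_dual {B D : K → Set K} {E F : K → K} {y : K}
    (h : IsPrimalSolution B D (ContinuousLinearMap.id ℝ K) E F y) :
    ∃ z, IsPrimalDualSolution B D (ContinuousLinearMap.id ℝ K) E F y z := by
  obtain ⟨b, hb, d, hd, h⟩ := h
  exact ⟨d, ⟨b, hb, h⟩, _, hd, by simp⟩

end

/-- The iteration is quasi-Fejér monotone with respect to `metricForm`, and its steps vanish. -/
theorem IsFHRDR.asymptotics {B D : K → Set K} {E F : K → K} {δ : ℝ≥0} {β τ ς : ℝ}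
    {y₀ ym1 z₀ : K} {y z : ℕ → K} (hB : IsMonotoneOp B) (hD : IsMonotoneOp D)
    (hE : IsMonotoneOp (fun x => {E x})) (hEL : LipschitzWith δ E)
    (hF : ∀ x y w : K, -(β / 4) * ‖w - x‖ ^ 2 ≤ ⟪F x - F y, w - y⟫_ℝ) (hβ : 0 ≤ β)
    (hτ : 0 < τ) (hς : 0 < ς) (hstep : τ * (ς⁻¹ + 2 * (δ : ℝ) + β / 2) < 1)
    (h : IsFHRDR B D E F τ ς y₀ ym1 z₀ y z) {ys zs : K}
    (hys : -(zs + E ys + F ys) ∈ B ys) (hzs : zs ∈ D ys) :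
    (∃ R, ∀ k, ‖y k‖ ≤ R ∧ ‖z k‖ ≤ R) ∧
    Tendsto (fun k => y (k + 1) - y k) atTop (𝓝 0) ∧
    Tendsto (fun k => z (k + 1) - z k) atTop (𝓝 0) ∧
    ∃ L, Tendsto (fun k => metricForm τ ς (y k - ys) (z k - zs)) atTop (𝓝 L) := by
  have hδ : (0 : ℝ) ≤ δ := δ.2
  have hEL' : ∀ u v, ‖E u - E v‖ ≤ δ * ‖u - v‖ := hEL.norm_sub_le
  obtain ⟨ε, hε, hcoer⟩ := metricForm_coercive (K := K) (γ := 2 * (δ : ℝ) + β / 2) hτ hς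
    (by rwa [← add_assoc])
  let Φ : ℕ → ℝ := fun k => metricForm τ ς (y k - ys) (z k - zs)
    - 2 * ⟪E (y k) - E (prev ym1 y k), y k - ys⟫_ℝ + δ * ‖y k - prev ym1 y k‖ ^ 2
  have hdesc : ∀ k, ε * (‖y (k + 1) - y k‖ ^ 2 + ‖z (k + 1) - z k‖ ^ 2) ≤ Φ k - Φ (k + 1) := by
    intro k
    obtain ⟨h1, h2⟩ := h.inclusions hτ hς k
    have m1 := hB _ _ _ _ h1 hys
    have m2 := hD _ _ _ _ h2 hzs
    have m3 := hE (y (k + 1)) (E (y (k + 1))) ys (E ys) rfl rfl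
    have m4 := hF (y k) ys (y (k + 1))
    have e1 : y (k + 1) - ys - (y k - ys) = y (k + 1) - y k := by abel
    have e2 : z (k + 1) - zs - (z k - zs) = z (k + 1) - z k := by abel
    have := energy_step (τ := τ) (ς := ς) (δ := δ) (β := β)
      (a := y k - ys) (a' := y (k + 1) - ys) (c := z k - zs)
      (c' := z (k + 1) - zs) (e := E (y k) - E (prev ym1 y k)) (e' := E (y (k + 1)) - E (y k))
      (g := E (y (k + 1)) - E ys) (p := F (y k) - F ys) (d := y k - prev ym1 y k)
      (by convert m1 using 2; module) (by convert m2 using 2; module) m3 (by rwa [e1]) hδ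
      (hEL' _ _)
    rw [e1, e2] at this
    have hc := hcoer (y (k + 1) - y k) (z (k + 1) - z k)
    change _ ≤ Φ k - _ at this
    change _ ≤ Φ k - (metricForm τ ς (y (k + 1) - ys) (z (k + 1) - zs)
      - 2 * ⟪E (y (k + 1)) - E (y k), y (k + 1) - ys⟫_ℝ + δ * ‖y (k + 1) - y k‖ ^ 2)
    linarith
  -- Young's inequality costs only `δ‖y k - ys‖²` for the cross term, less than the `(2δ + β/2)‖y k
  -- - ys‖²` that coercivity leaves available.
  have hlow : ∀ k, ε * (‖y k - ys‖ ^ 2 + ‖z k - zs‖ ^ 2) ≤ Φ k := by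
    intro k
    have hc := hcoer (y k - ys) (z k - zs)
    have h1 := real_inner_le_norm (E (y k) - E (prev ym1 y k)) (y k - ys)
    have h2 := mul_le_mul_of_nonneg_right (hEL' (y k) (prev ym1 y k)) (norm_nonneg (y k - ys))
    have h3 := mul_nonneg hδ (sq_nonneg (‖y k - prev ym1 y k‖ - ‖y k - ys‖))
    have h4 := mul_nonneg hδ (sq_nonneg ‖y k - ys‖)
    have h5 := mul_nonneg hβ (sq_nonneg ‖y k - ys‖)
    simp only [Φ]
    nlinarith
  have hanti : Antitone Φ := antitone_nat_of_succ_le fun k => by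
    have := hdesc k
    have : 0 ≤ ε * (‖y (k + 1) - y k‖ ^ 2 + ‖z (k + 1) - z k‖ ^ 2) := by positivity
    linarith
  have hbb : BddBelow (Set.range Φ) := ⟨0, by
    rintro _ ⟨k, rfl⟩
    exact le_trans (by positivity) (hlow k)⟩
  have hlim := tendsto_atTop_ciInf hanti hbb
  set L := ⨅ k, Φ k
  have hdiff : Tendsto (fun k => ε⁻¹ * (Φ k - Φ (k + 1))) atTop (𝓝 0) := by
    have := (hlim.sub (hlim.comp (tendsto_add_atTop_nat 1))).const_mul ε⁻¹
    simpa using this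
  have hdiff' : ∀ k, ‖y (k + 1) - y k‖ ^ 2 + ‖z (k + 1) - z k‖ ^ 2 ≤ ε⁻¹ * (Φ k - Φ (k + 1)) := by
    intro k
    rw [le_inv_mul_iff₀ hε]
    exact hdesc k
  have hsq : ∀ w : ℕ → K, (∀ k, ‖w k‖ ^ 2 ≤ ε⁻¹ * (Φ k - Φ (k + 1))) → Tendsto w atTop (𝓝 0) := by
    intro w hw
    have h1 : Tendsto (fun k => ‖w k‖ ^ 2) atTop (𝓝 0) :=
      squeeze_zero (fun k => by positivity) hw hdiff
    have h2 := (Real.continuous_sqrt.tendsto 0).comp h1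
    rw [tendsto_zero_iff_norm_tendsto_zero]
    simpa [Function.comp_def, Real.sqrt_sq] using h2
  have hy : Tendsto (fun k => y (k + 1) - y k) atTop (𝓝 0) := hsq _ fun k =>
    le_trans (le_add_of_nonneg_right (by positivity)) (hdiff' k)
  have hz : Tendsto (fun k => z (k + 1) - z k) atTop (𝓝 0) := hsq _ fun k =>
    le_trans (le_add_of_nonneg_left (by positivity)) (hdiff' k)
  obtain ⟨M, hM⟩ : ∃ M, ∀ k, ‖y k - ys‖ ≤ M ∧ ‖z k - zs‖ ≤ M := by
    have hb : ∀ k, ‖y k - ys‖ ^ 2 + ‖z k - zs‖ ^ 2 ≤ ε⁻¹ * Φ 0 := fun k => by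
      rw [le_inv_mul_iff₀ hε]
      exact (hlow k).trans (hanti (Nat.zero_le k))
    exact ⟨√(ε⁻¹ * Φ 0), fun k =>
      ⟨Real.le_sqrt_of_sq_le (le_trans (le_add_of_nonneg_right (by positivity)) (hb k)),
        Real.le_sqrt_of_sq_le (le_trans (le_add_of_nonneg_left (by positivity)) (hb k))⟩⟩
  refine ⟨⟨M + ‖ys‖ + ‖zs‖, fun k => ⟨?_, ?_⟩⟩, hy, hz, L, ?_⟩
  · have := norm_sub_norm_le (y k) ys
    linarith [(hM k).1, norm_nonneg zs]
  · have := norm_sub_norm_le (z k) zs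
    linarith [(hM k).2, norm_nonneg ys]
  -- After the shift, `prev` is `y k` and the arbitrary `ym1` no longer occurs; both correction
  -- terms of `Φ` tend to `0`.
  · rw [← tendsto_add_atTop_iff_nat 1]
    have hn : Tendsto (fun k => ‖y (k + 1) - y k‖) atTop (𝓝 0) := by simpa using hy.norm
    have h1 : Tendsto (fun k => ⟪E (y (k + 1)) - E (y k), y (k + 1) - ys⟫_ℝ) atTop (𝓝 0) := by
      refine squeeze_zero_norm (a := fun k => δ * ‖y (k + 1) - y k‖ * M) (fun k => ?_) ?_
      · refine (norm_inner_le_norm _ _).trans ?_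
        exact mul_le_mul (hEL' _ _) (hM _).1 (norm_nonneg _) (by positivity)
      · simpa using (hn.const_mul (δ : ℝ)).mul_const M
    have h2 := ((hlim.comp (tendsto_add_atTop_nat 1)).add (h1.const_mul 2)).sub
      ((hn.pow 2).const_mul (δ : ℝ))
    have h3 : L + 2 * 0 - δ * 0 ^ 2 = L := by ring
    rw [h3] at h2
    refine h2.congr fun k => ?_
    simp only [Function.comp_apply, Φ, prev]
    ring

/-- A weak limit point of the iterates is a primal-dual solution. -/
theorem IsFHRDR.mem_of_weak_limit [CompleteSpace K] {B D : K → Set K} {E F : K → K} {δ : ℝ≥0}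
    {β τ ς : ℝ} {y₀ ym1 z₀ : K} {y z : ℕ → K} (hB : IsMaximallyMonotone B)
    (hD : IsMaximallyMonotone D) (hE : IsMonotoneOp (fun x => {E x})) (hEL : LipschitzWith δ E)
    (hF : ∀ x y : K, 0 ≤ ⟪F x - F y, x - y⟫_ℝ) (hβ : 0 ≤ β)
    (hFL : ∀ x y : K, ‖F x - F y‖ ≤ β * ‖x - y‖)
    (hτ : 0 < τ) (hς : 0 < ς) (h : IsFHRDR B D E F τ ς y₀ ym1 z₀ y z)
    (hbd : ∃ R, ∀ k, ‖y k‖ ≤ R ∧ ‖z k‖ ≤ R)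
    (hdy : Tendsto (fun k => y (k + 1) - y k) atTop (𝓝 0))
    (hdz : Tendsto (fun k => z (k + 1) - z k) atTop (𝓝 0))
    {U : Filter ℕ} [U.NeBot] (hU : U ≤ atTop) {ys zs : K}
    (hy : ∀ w : K, Tendsto (fun k => ⟪y k, w⟫_ℝ) U (𝓝 ⟪ys, w⟫_ℝ))
    (hz : ∀ w : K, Tendsto (fun k => ⟪z k, w⟫_ℝ) U (𝓝 ⟪zs, w⟫_ℝ)) :
    -(zs + E ys + F ys) ∈ B ys ∧ zs ∈ D ys := by
  obtain ⟨R, hR⟩ := hbd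
  have hEL' : ∀ u v, ‖E u - E v‖ ≤ δ * ‖u - v‖ := hEL.norm_sub_le
  have hshift : ∀ {f : ℕ → K} {l : K}, Tendsto (fun k => f (k + 1) - f k) atTop (𝓝 0) →
      (∀ w : K, Tendsto (fun k => ⟪f k, w⟫_ℝ) U (𝓝 ⟪l, w⟫_ℝ)) →
      ∀ w : K, Tendsto (fun k => ⟪f (k + 1), w⟫_ℝ) U (𝓝 ⟪l, w⟫_ℝ) := by
    intro f l hd hf w
    have h1 := (hf w).add ((hd.mono_left hU).inner (tendsto_const_nhds (x := w)))
    rw [inner_zero_left, add_zero] at h1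
    refine h1.congr fun k => ?_
    rw [← inner_add_left]
    congr 1
    abel
  have hy' := hshift hdy hy
  have hz' := hshift hdz hz
  -- Residuals of (PD) at `(y (k + 1), z (k + 1))`: the element of `B` is `r k - z (k + 1) - E (y (k
  -- + 1)) - F (y (k + 1))`, and the argument of `D` is `y (k + 1) + s k`. Both tend to `0`
  -- strongly.
  let r : ℕ → K := fun k => τ⁻¹ • (y k - y (k + 1)) + (z (k + 1) - z k)
    - ((2 : ℝ) • E (y k) - E (prev ym1 y k) - E (y (k + 1))) - (F (y k) - F (y (k + 1)))
  let s : ℕ → K := fun k => (y (k + 1) - y k) - ς • (z (k + 1) - z k)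
  have hs : Tendsto s atTop (𝓝 0) := by
    simpa [s] using hdy.sub (hdz.const_smul ς)
  have hEd : Tendsto (fun k => E (y (k + 1)) - E (y k)) atTop (𝓝 0) :=
    squeeze_zero_norm (fun k => hEL' _ _) (by simpa using hdy.norm.const_mul (δ : ℝ))
  have hFd : Tendsto (fun k => F (y (k + 1)) - F (y k)) atTop (𝓝 0) :=
    squeeze_zero_norm (fun k => hFL _ _) (by simpa using hdy.norm.const_mul β)
  have hEp : Tendsto (fun k => E (y k) - E (prev ym1 y k)) atTop (𝓝 0) :=
    (tendsto_add_atTop_iff_nat 1).1 hEd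
  have hr : Tendsto r atTop (𝓝 0) := by
    have := (((hdy.const_smul (-τ⁻¹)).add hdz).sub (hEp.sub hEd)).add hFd
    simp only [smul_zero, add_zero, sub_zero] at this
    refine this.congr fun k => ?_
    simp only [r]
    module
  have hbi : ∀ {f g : ℕ → K} {M : ℝ}, Tendsto f atTop (𝓝 0) → (∀ k, ‖g k‖ ≤ M) →
      Tendsto (fun k => ⟪f k, g k⟫_ℝ) U (𝓝 0) := by
    intro f g M hf hg
    refine squeeze_zero_norm (a := fun k => ‖f k‖ * M) (fun k => ?_) ?_
    · exact (norm_inner_le_norm _ _).trans (mul_le_mul_of_nonneg_left (hg k) (norm_nonneg _))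
    · simpa using (hf.mono_left hU).norm.mul_const M
  -- the limiting inequality
  have hlim : ∀ x b v d : K, b ∈ B x → d ∈ D v →
      0 ≤ -⟪b + E x + F x + d, ys - x⟫_ℝ + ⟪x - v, zs - d⟫_ℝ := by
    intro x b v d hb hd
    have ht := (((hbi (g := fun k => y (k + 1) - x) (M := R + ‖x‖) hr fun k =>
        (norm_sub_le _ _).trans (by linarith [(hR (k + 1)).1])).add
      (hbi (g := fun k => z (k + 1) - d) (M := R + ‖d‖) hs fun k =>
        (norm_sub_le _ _).trans (by linarith [(hR (k + 1)).2]))).sub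
      (hy' (b + E x + F x + d))).add (hz' (x - v))
    have ht2 := ht.add_const (⟪x, b + E x + F x + d⟫_ℝ - ⟪d, x - v⟫_ℝ)
    have hge := ge_of_tendsto' (b := (0 : ℝ)) ht2 fun k => ?_
    · have e1 := real_inner_comm (b + E x + F x + d) (ys - x)
      have e2 := real_inner_comm (x - v) (zs - d)
      rw [inner_sub_left] at e1 e2
      linarith
    · obtain ⟨h1, h2⟩ := h.inclusions hτ hς k
      have m1 := hB.1 _ _ _ _ h1 hb
      have m2 := hD.1 _ _ _ _ h2 hd
      have m3 := hE (y (k + 1)) (E (y (k + 1))) x (E x) rfl rfl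
      have m4 := hF (y (k + 1)) x
      -- When the two inequalities are added, the bilinear term `⟪z (k + 1) - d, y (k + 1) - x⟫`
      -- cancels. Apart from the residual products, only terms affine in the iterates remain, and
      -- these pass to weak limits.
      have e1 : τ⁻¹ • (y k - y (k + 1)) - z k - ((2 : ℝ) • E (y k) - E (prev ym1 y k)) - F (y k) - b
          = r k - (E (y (k + 1)) - E x) - (F (y (k + 1)) - F x) - (b + E x + F x + d)
            - (z (k + 1) - d) := by
        simp only [r]; module
      have e2 : (2 : ℝ) • y (k + 1) - y k - ς • (z (k + 1) - z k) - v
          = s k + (y (k + 1) - x) + (x - v) := by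
        simp only [s]; module
      rw [e1] at m1
      rw [e2, inner_add_right, inner_add_right] at m2
      rw [inner_sub_left, inner_sub_left, inner_sub_left, inner_sub_left] at m1
      have e3 := real_inner_comm (z (k + 1) - d) (s k)
      have e4 := real_inner_comm (b + E x + F x + d) (y (k + 1) - x)
      have e5 : ⟪y (k + 1) - x, b + E x + F x + d⟫_ℝ
        = ⟪y (k + 1), b + E x + F x + d⟫_ℝ - ⟪x, b + E x + F x + d⟫_ℝ := inner_sub_left _ _ _
      have e6 : ⟪z (k + 1) - d, x - v⟫_ℝ = ⟪z (k + 1), x - v⟫_ℝ - ⟪d, x - v⟫_ℝ :=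
        inner_sub_left _ _ _
      linarith
  -- test the limiting inequality at resolvent points
  set t : ℝ := (δ + β + 1)⁻¹ with ht
  have hδ : (0 : ℝ) ≤ δ := δ.2
  have ht0 : 0 < t := by positivity
  have hti : t⁻¹ = δ + β + 1 := inv_inv _
  obtain ⟨x, b, hb, hxb⟩ := hB.exists_mem_resolvent ht0 (ys - t • (zs + E ys + F ys))
  obtain ⟨v, d, hd, hvd⟩ := hD.exists_mem_resolvent (inv_pos.2 ht0) (ys + t⁻¹ • zs)
  have hb' : b = t⁻¹ • (ys - x) - (zs + E ys + F ys) := by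
    have : t • b = ys - x - t • (zs + E ys + F ys) := by
      linear_combination (norm := module) -hxb
    rw [← inv_smul_smul₀ ht0.ne' b, this, smul_sub, inv_smul_smul₀ ht0.ne']
  have hv' : v = ys + t⁻¹ • (zs - d) := by
    linear_combination (norm := module) -hvd
  have hfin := hlim x b v d hb hd
  -- The reciprocal resolvent parameters `t` and `t⁻¹` make the mixed terms cancel. As `t⁻¹ = δ + β
  -- + 1` exceeds the Lipschitz constant `δ + β` of `E + F`, both squares must vanish, so the test
  -- points are `(ys, zs)` itself.
  have e : -⟪b + E x + F x + d, ys - x⟫_ℝ + ⟪x - v, zs - d⟫_ℝ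
      = -(t⁻¹ * ‖ys - x‖ ^ 2) - t⁻¹ * ‖zs - d‖ ^ 2 + ⟪E ys - E x, ys - x⟫_ℝ
        + ⟪F ys - F x, ys - x⟫_ℝ := by
    have e1 : b + E x + F x + d
        = t⁻¹ • (ys - x) - (zs - d) - (E ys - E x) - (F ys - F x) := by rw [hb']; abel
    have e2 : x - v = -(ys - x) - t⁻¹ • (zs - d) := by rw [hv']; abel
    rw [e1, e2, inner_sub_left, inner_sub_left, inner_sub_left _ (zs - d), inner_sub_left (-(ys - x)),
      inner_neg_left,
      real_inner_smul_left, real_inner_smul_left, real_inner_self_eq_norm_sq,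
      real_inner_self_eq_norm_sq, real_inner_comm (ys - x) (zs - d)]
    ring
  have hE1 : ⟪E ys - E x, ys - x⟫_ℝ ≤ δ * ‖ys - x‖ ^ 2 := by
    refine (real_inner_le_norm _ _).trans ?_
    rw [pow_two, ← mul_assoc]
    exact mul_le_mul_of_nonneg_right (hEL' _ _) (norm_nonneg _)
  have hF1 : ⟪F ys - F x, ys - x⟫_ℝ ≤ β * ‖ys - x‖ ^ 2 := by
    refine (real_inner_le_norm _ _).trans ?_
    rw [pow_two, ← mul_assoc]
    exact mul_le_mul_of_nonneg_right (hFL _ _) (norm_nonneg _)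
  have hzd0 : 0 ≤ (δ + β) * ‖zs - d‖ ^ 2 := by positivity
  rw [e, hti] at hfin
  have hx : ys - x = 0 := norm_eq_zero.1 (pow_eq_zero_iff two_ne_zero |>.1
    (le_antisymm (by linarith [sq_nonneg ‖zs - d‖]) (sq_nonneg _)))
  have hd0 : zs - d = 0 := norm_eq_zero.1 (pow_eq_zero_iff two_ne_zero |>.1
    (le_antisymm (by linarith [sq_nonneg ‖ys - x‖]) (sq_nonneg _)))
  rw [hx, smul_zero, zero_sub] at hb'
  rw [hd0, smul_zero, add_zero] at hv'
  rw [← hb', sub_eq_zero.1 hx, sub_eq_zero.1 hd0]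
  rw [hv', sub_eq_zero.1 hx] at hd
  exact ⟨hb, hd⟩

/-- The quadratic terms in `(a, b)` cancel, so a difference of squared distances is affine in `(a,
b)` and can be followed along weak limits. -/
theorem metricForm_sub_sub_sub (τ ς : ℝ) (a b a₁ b₁ a₂ b₂ : K) :
    metricForm τ ς (a - a₁) (b - b₁) - metricForm τ ς (a - a₂) (b - b₂)
      = metricForm τ ς a₁ b₁ - metricForm τ ς a₂ b₂
        - 2 * metricInner τ ς a b (a₁ - a₂) (b₁ - b₂) := by
  simp only [metricForm, metricInner, ← real_inner_self_eq_norm_sq, inner_sub_left,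
    inner_sub_right, real_inner_comm a a₁, real_inner_comm a a₂, real_inner_comm b b₁,
    real_inner_comm b b₂, real_inner_comm b a₁, real_inner_comm b a₂]
  ring

/-- Opial's argument: weak limit points are unique if the distances to them, in the metric given by
`metricForm`, converge. -/
theorem weak_limit_unique {τ ς ε : ℝ} (hε : 0 < ε)
    (hcoer : ∀ a b : K, ε * (‖a‖ ^ 2 + ‖b‖ ^ 2) ≤ metricForm τ ς a b)
    {y z : ℕ → K} {U₁ U₂ : Filter ℕ} [U₁.NeBot] [U₂.NeBot] (hU₁ : U₁ ≤ atTop) (hU₂ : U₂ ≤ atTop)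
    {y₁ z₁ y₂ z₂ : K}
    (hy₁ : ∀ w : K, Tendsto (fun k => ⟪y k, w⟫_ℝ) U₁ (𝓝 ⟪y₁, w⟫_ℝ))
    (hz₁ : ∀ w : K, Tendsto (fun k => ⟪z k, w⟫_ℝ) U₁ (𝓝 ⟪z₁, w⟫_ℝ))
    (hy₂ : ∀ w : K, Tendsto (fun k => ⟪y k, w⟫_ℝ) U₂ (𝓝 ⟪y₂, w⟫_ℝ))
    (hz₂ : ∀ w : K, Tendsto (fun k => ⟪z k, w⟫_ℝ) U₂ (𝓝 ⟪z₂, w⟫_ℝ))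
    (h₁ : ∃ L, Tendsto (fun k => metricForm τ ς (y k - y₁) (z k - z₁)) atTop (𝓝 L))
    (h₂ : ∃ L, Tendsto (fun k => metricForm τ ς (y k - y₂) (z k - z₂)) atTop (𝓝 L)) :
    y₁ = y₂ ∧ z₁ = z₂ := by
  obtain ⟨L₁, h₁⟩ := h₁
  obtain ⟨L₂, h₂⟩ := h₂
  have hI : ∀ {U : Filter ℕ} {ys zs : K},
      (∀ w : K, Tendsto (fun k => ⟪y k, w⟫_ℝ) U (𝓝 ⟪ys, w⟫_ℝ)) →
      (∀ w : K, Tendsto (fun k => ⟪z k, w⟫_ℝ) U (𝓝 ⟪zs, w⟫_ℝ)) → ∀ w w' : K,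
      Tendsto (fun k => metricInner τ ς (y k) (z k) w w') U (𝓝 (metricInner τ ς ys zs w w')) :=
    fun hy hz w w' => ((((hy w).const_mul _).sub (hy w')).sub (hz w)).add ((hz w').const_mul _)
  have hd := h₁.sub h₂
  simp only [metricForm_sub_sub_sub] at hd
  -- The affine function converges along `atTop`, so its values at the two weak limits agree; their
  -- difference is twice the squared metric distance between these limits.
  have t₁ := tendsto_nhds_unique (hd.mono_left hU₁)
    (((hI hy₁ hz₁ (y₁ - y₂) (z₁ - z₂)).const_mul 2).const_sub _)
  have t₂ := tendsto_nhds_unique (hd.mono_left hU₂)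
    (((hI hy₂ hz₂ (y₁ - y₂) (z₁ - z₂)).const_mul 2).const_sub _)
  have e : metricForm τ ς (y₁ - y₂) (z₁ - z₂)
      = metricInner τ ς y₁ z₁ (y₁ - y₂) (z₁ - z₂) - metricInner τ ς y₂ z₂ (y₁ - y₂) (z₁ - z₂) := by
    simp only [metricForm, metricInner, ← real_inner_self_eq_norm_sq, inner_sub_left,
      inner_sub_right, real_inner_comm y₁ z₁, real_inner_comm y₁ z₂, real_inner_comm y₂ z₁,
      real_inner_comm y₂ z₂]
    ring
  have h0 := hcoer (y₁ - y₂) (z₁ - z₂)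
  have h3 : ‖y₁ - y₂‖ ^ 2 + ‖z₁ - z₂‖ ^ 2 ≤ 0 := by
    refine nonpos_of_mul_nonpos_right ?_ hε
    linarith
  have h4 := sq_nonneg ‖y₁ - y₂‖
  have h5 := sq_nonneg ‖z₁ - z₂‖
  exact ⟨sub_eq_zero.1 (norm_eq_zero.1 (pow_eq_zero_iff two_ne_zero |>.1 (by linarith))),
    sub_eq_zero.1 (norm_eq_zero.1 (pow_eq_zero_iff two_ne_zero |>.1 (by linarith)))⟩

theorem IsFHRDR.exists_weaklyConverges [CompleteSpace K] {B D : K → Set K} {E F : K → K} {δ : ℝ≥0}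
    {β τ ς : ℝ} {y₀ ym1 z₀ : K} {y z : ℕ → K} (hτ : 0 < τ) (hς : 0 < ς)
    (hA : ProblemAssumptions B D (ContinuousLinearMap.id ℝ K) E F δ β)
    (hstep : τ * (ς⁻¹ + 2 * (δ : ℝ) + β / 2) < 1) (h : IsFHRDR B D E F τ ς y₀ ym1 z₀ y z) :
    ∃ ystar zstar : K, WeaklyConverges y ystar ∧ WeaklyConverges z zstar ∧
      IsPrimalSolution B D (ContinuousLinearMap.id ℝ K) E F ystar ∧
      IsPrimalDualSolution B D (ContinuousLinearMap.id ℝ K) E F ystar zstar := by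
  obtain ⟨hβ, hFL, hF⟩ : 0 ≤ β ∧ (∀ x y : K, ‖F x - F y‖ ≤ β * ‖x - y‖) ∧
      ∀ x y w : K, -(β / 4) * ‖w - x‖ ^ 2 ≤ ⟪F x - F y, w - y⟫_ℝ := by
    rcases hA.cocoercive_F with hF | ⟨rfl, rfl⟩
    · exact ⟨hF.1.le, hF.norm_sub_le, hF.le_inner⟩
    · simp
  -- Taking the third point equal to `x` kills the error term and leaves monotonicity.
  have hFm : ∀ x y : K, 0 ≤ ⟪F x - F y, x - y⟫_ℝ := fun x y => by simpa using hF x y x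
  obtain ⟨yp, hyp⟩ := hA.exists_solution
  obtain ⟨zp, hzp⟩ := hyp.exists_dual
  rw [isPrimalDualSolution_id_iff] at hzp
  -- Stated for an arbitrary solution: the given one yields boundedness, and the weak limit points
  -- themselves are used later in Opial's argument.
  have hasym {ys zs : K} (hys : -(zs + E ys + F ys) ∈ B ys ∧ zs ∈ D ys) :=
    h.asymptotics hA.maxMono_B.1 hA.maxMono_D.1 hA.mono_E hA.lipschitz_E hF hβ hτ hς hstep
      hys.1 hys.2
  obtain ⟨hbd, hdy, hdz, -⟩ := hasym hzp
  have hcl : ∀ U : Ultrafilter ℕ, (U : Filter ℕ) ≤ atTop → ∃ ys zs : K,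
      (∀ w : K, Tendsto (fun k => ⟪y k, w⟫_ℝ) U (𝓝 ⟪ys, w⟫_ℝ)) ∧
      (∀ w : K, Tendsto (fun k => ⟪z k, w⟫_ℝ) U (𝓝 ⟪zs, w⟫_ℝ)) ∧
      (-(zs + E ys + F ys) ∈ B ys ∧ zs ∈ D ys) := by
    intro U hU
    obtain ⟨R, hR⟩ := hbd
    obtain ⟨ys, hys⟩ := exists_weak_limit_ultrafilter U y R fun k => (hR k).1
    obtain ⟨zs, hzs⟩ := exists_weak_limit_ultrafilter U z R fun k => (hR k).2
    exact ⟨ys, zs, hys, hzs, h.mem_of_weak_limit hA.maxMono_B hA.maxMono_D hA.mono_E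
      hA.lipschitz_E hFm hβ hFL hτ hς ⟨R, hR⟩ hdy hdz hU hys hzs⟩
  obtain ⟨ε, hε, hcoer⟩ := metricForm_coercive (K := K) (γ := 2 * (δ : ℝ) + β / 2) hτ hς
    (by rwa [← add_assoc])
  have hcoer' : ∀ a b : K, ε * (‖a‖ ^ 2 + ‖b‖ ^ 2) ≤ metricForm τ ς a b := fun a b =>
    (hcoer a b).trans (sub_le_self _ (by positivity))
  have hU₀ := Ultrafilter.of_le (atTop : Filter ℕ)
  obtain ⟨ys, zs, hys, hzs, hsol⟩ := hcl _ hU₀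
  -- All ultrafilters below `atTop` share one weak limit, which is convergence of the full sequence.
  have huniq : ∀ U : Ultrafilter ℕ, (U : Filter ℕ) ≤ atTop → ∀ w : K,
      Tendsto (fun k => ⟪y k, w⟫_ℝ) U (𝓝 ⟪ys, w⟫_ℝ) ∧
      Tendsto (fun k => ⟪z k, w⟫_ℝ) U (𝓝 ⟪zs, w⟫_ℝ) := by
    intro U hU w
    obtain ⟨ys', zs', hys', hzs', hsol'⟩ := hcl U hU
    obtain ⟨rfl, rfl⟩ := weak_limit_unique hε hcoer' hU₀ hU hys hzs hys' hzs'
      (hasym hsol).2.2.2 (hasym hsol').2.2.2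
    exact ⟨hys' w, hzs' w⟩
  have hPD := isPrimalDualSolution_id_iff.2 hsol
  refine ⟨ys, zs, ?_, ?_, hPD.isPrimalSolution, hPD⟩
  · rw [weaklyConverges_iff_inner]
    exact fun w => (tendsto_iff_ultrafilter _ _ _).2 fun U hU => (huniq U hU w).1
  · rw [weaklyConverges_iff_inner]
    exact fun w => (tendsto_iff_ultrafilter _ _ _).2 fun U hU => (huniq U hU w).2

end Convergence

end FHRDR

theorem corollary6p4 {K : Type*} [NormedAddCommGroup K] [InnerProductSpace ℝ K] [CompleteSpace K]
    (B D : K → Set K) (E : K → K) (δ : ℝ≥0) (τ ς : ℝ) (hτ : 0 < τ) (hς : 0 < ς)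
    (y₀ ym1 z₀ : K) :
    -- the forward-half-reflected-Douglas--Rachford method
    (∀ (F : K → K) (β : ℝ),
      FHRDR.ProblemAssumptions B D (ContinuousLinearMap.id ℝ K) E F δ β →
      τ * (ς⁻¹ + 2 * (δ : ℝ) + β / 2) < 1 →
      (∃! p : (ℕ → K) × (ℕ → K), FHRDR.IsFHRDR B D E F τ ς y₀ ym1 z₀ p.1 p.2) ∧
      ∀ y z : ℕ → K, FHRDR.IsFHRDR B D E F τ ς y₀ ym1 z₀ y z →
        ∃ ystar zstar : K,
          FHRDR.WeaklyConverges y ystar ∧ FHRDR.WeaklyConverges z zstar ∧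
          FHRDR.IsPrimalSolution B D (ContinuousLinearMap.id ℝ K) E F ystar ∧
          FHRDR.IsPrimalDualSolution B D (ContinuousLinearMap.id ℝ K) E F ystar zstar) ∧
    -- the case without cocoercive term: forward-reflected-Douglas--Rachford
    (FHRDR.ProblemAssumptions B D (ContinuousLinearMap.id ℝ K) E 0 δ 0 →
      τ * (ς⁻¹ + 2 * (δ : ℝ)) < 1 →
      (∃! p : (ℕ → K) × (ℕ → K), FHRDR.IsFRDR B D E τ ς y₀ ym1 z₀ p.1 p.2) ∧
      ∀ y z : ℕ → K, FHRDR.IsFRDR B D E τ ς y₀ ym1 z₀ y z →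
        ∃ ystar zstar : K,
          FHRDR.WeaklyConverges y ystar ∧ FHRDR.WeaklyConverges z zstar ∧
          FHRDR.IsPrimalSolution B D (ContinuousLinearMap.id ℝ K) E 0 ystar ∧
          FHRDR.IsPrimalDualSolution B D (ContinuousLinearMap.id ℝ K) E 0 ystar zstar) := by
  constructor
  · intro F β hA hstep
    exact ⟨FHRDR.existsUnique_isFHRDR hA.maxMono_B hA.maxMono_D E F hτ hς y₀ ym1 z₀,
      fun y z h => h.exists_weaklyConverges hτ hς hA hstep⟩
  · intro hA hstep
    simp only [FHRDR.isFRDR_iff_isFHRDR_zero]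
    exact ⟨FHRDR.existsUnique_isFHRDR hA.maxMono_B hA.maxMono_D E 0 hτ hς y₀ ym1 z₀,
      fun y z h => h.exists_weaklyConverges hτ hς hA (by simpa using hstep)⟩
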